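/- Let $F$ be a field and let $K$ be the field of formal power series in $t$ with real exponents (well-ordered support) and coefficients in $F$. For an ideal $I\subseteq K[x_1,\dots,x_d]$ let $T(I)\subseteq\mathbb R^d$ be the set of vectors $(\operatorname{ord}_t x_1,\dots,\operatorname{ord}_t x_d)$, where $x\in (K\setminus\{0\})^d$ is a common zero of $I$. A tropical linear space is a set $T(I)$ with $I$ generated by (homogeneous) linear forms; its dimension is $d$ minus the minimal number of generators of $I$. The Kapranov rank over $F$ of a real matrix is the least dimension of a tropical linear space containing its rows. Let $M=(m_{ij})$ be a real $n\times n$ matrix. (1) Suppose that $F$ is infinite and that all entries of $M$ are $0$ or $1$. If $M$ does not have both a row consisting only of ones and a column consisting only of ones, then the Kapranov rank of $M$ over $F$ is the least $k$ for which there are vectors $v\langle 1\rangle,\dots,v\langle n\rangle,w\langle 1\rangle,\dots,w\langle n\rangle\in F^k$ such that, for all $i,j$, $m_{ij}=0$ if and only if $v\langle i\rangle\, w\langle j\rangle^T\neq 0$ (that is, $m_{ij}=1$ if and only if $v\langle i\rangle\, w\langle j\rangle^T=0$). For an arbitrary $(0,1)$-matrix $M$, the Kapranov rank is the least $k$ for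 which there are such vectors with the additional property that, for all $i,j$, the vectors $v\langle i\rangle$ and $w\langle j\rangle$ are not both zero. (2) Let $F$ be an arbitrary field and let all entries of $M$ be nonnegative. Then the Kapranov rank of $M$ over $F$ is the least $k$ for which there are vectors $v\langle 1\rangle,\dots,v\langle n\rangle,w\langle 1\rangle,\dots,w\langle n\rangle$ in $K_+^k$, where $K_+\subseteq K$ is the ring of power series involving only nonnegative powers of $t$, such that, for all $i,j$, the order in $t$ of $v\langle i\rangle\, w\langle j\rangle^T$ is exactly $m_{ij}$. -/

import Mathlib

open Matrix

noncomputable section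

namespace KapranovRank

/-- The field `K` of power series in an indeterminate `t`, with arbitrary real exponents
(well-ordered support) and coefficients in `F`. The order in `t` is `HahnSeries.orderTop`. -/
abbrev SeriesField (F : Type*) [Field F] : Type _ := HahnSeries ℝ F

/-- The subring of `SeriesField F` of the power series which involve only nonnegative
powers of `t`. -/
def nonnegSeries (F : Type*) [Field F] : Subring (SeriesField F) where
  carrier := {x | 0 ≤ x.orderTop}
  mul_mem' := by
    intro a b ha hb
    have h : (0 : WithTop ℝ) ≤ a.orderTop + b.orderTop := add_nonneg ha hb
    exact h.trans HahnSeries.orderTop_add_le_mul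
  one_mem' := by
    simp
  add_mem' := by
    intro a b ha hb
    have h : (0 : WithTop ℝ) ≤ min a.orderTop b.orderTop := le_min ha hb
    exact h.trans HahnSeries.min_orderTop_le_orderTop_add
  zero_mem' := by simp
  neg_mem' := by
    intro a ha
    simpa using ha

/-- The tropical variety `T(I)` of an ideal `I` of `K[x_1, …, x_d]`: the image in `ℝ^d`, under the
coordinatewise order in `t`, of the common zeros of `I` all of whose coordinates are nonzero. -/
def tropicalVariety {F : Type*} [Field F] {d : ℕ}
    (I : Ideal (MvPolynomial (Fin d) (SeriesField F))) : Set (Fin d → ℝ) :=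
  {y | ∃ x : Fin d → SeriesField F, (∀ j, x j ≠ 0) ∧ (∀ p ∈ I, MvPolynomial.eval x p = 0) ∧
    ∀ j, (x j).orderTop = (y j : WithTop ℝ)}

/-- The ideal `I` is generated by (homogeneous) linear forms. -/
def GeneratedByLinearForms {F : Type*} [Field F] {d : ℕ}
    (I : Ideal (MvPolynomial (Fin d) (SeriesField F))) : Prop :=
  ∃ S : Set (MvPolynomial (Fin d) (SeriesField F)),
    (∀ p ∈ S, p.IsHomogeneous 1) ∧ I = Ideal.span S

/-- `T ⊆ ℝ^d` is a tropical linear space of dimension `D` over `F`: it is `T(I)` for an ideal `I`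
generated by linear forms, and `D` is `d` minus the minimal number of generators of `I`. -/
def IsTropicalLinearSpace (F : Type*) [Field F] {d : ℕ} (T : Set (Fin d → ℝ)) (D : ℕ) : Prop :=
  ∃ I : Ideal (MvPolynomial (Fin d) (SeriesField F)),
    GeneratedByLinearForms I ∧ T = tropicalVariety I ∧ D + Submodule.spanFinrank I = d

/-- The Kapranov rank over `F` of a matrix: the least dimension of a tropical linear space
containing its rows. -/
def kapranovRank (F : Type*) [Field F] {m d : ℕ} (M : Matrix (Fin m) (Fin d) ℝ) : ℕ :=
  sInf {D | ∃ T : Set (Fin d → ℝ), IsTropicalLinearSpace F T D ∧ ∀ i, M i ∈ T}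

/-- The whole of `ℝ^d` is a tropical linear space of dimension `d` containing the rows, so the
infimum in `kapranovRank` is over a nonempty set. -/
theorem kapranovRank_set_nonempty (F : Type*) [Field F] {m d : ℕ} (M : Matrix (Fin m) (Fin d) ℝ) :
    {D | ∃ T : Set (Fin d → ℝ), IsTropicalLinearSpace F T D ∧ ∀ i, M i ∈ T}.Nonempty := by
  refine ⟨d, tropicalVariety (F := F) ⊥, ⟨⊥, ⟨∅, by simp, by simp⟩, rfl, by simp⟩, fun i => ?_⟩
  refine ⟨fun j => HahnSeries.single (M i j) 1, fun j => ?_, ?_, fun j => ?_⟩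
  · simp
  · intro p hp
    have hp0 : p = 0 := by simpa using hp
    simp [hp0]
  · exact HahnSeries.orderTop_single one_ne_zero

end KapranovRank

end

/-! A common zero of linear forms stays one under linear combinations, so the Kapranov rank is the
least rank of a lift of `M`, a matrix over `K` whose entries have the entries of `M` as orders
(`kapranovRank_le_rank`, `exists_isLift_rank_eq`).

For (2), a lift `X` of rank `k` must factor through `k` vectors over `K_+`. By
`exists_linearIndepOn_subset`, `k` rows of `X` itself generate all rows with coefficients in `K_+`;
if `M` is nonnegative, these rows also have entries in `K_+`. Conversely, a factorization of length
`k` multiplies out to a lift of rank at most `k`.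

For (1), constant terms of such a factorization give the vectors over `F`. Conversely, vectors over
`F` are perturbed to `v + t a` and `w + t b`; where `v w = 0`, the product has order 1 as soon as
its coefficient of `t` is nonzero. If `v` and `w` are never both zero, this holds for a generic
choice, since `F` is infinite. -/

noncomputable section

namespace KapranovRank

/-! ### Generators of ideals of linear forms -/

section LinearForms

variable {K : Type*} [Field K] {d : ℕ}

/-- The coefficients of the linear part of a polynomial. -/
def linearCoeff : MvPolynomial (Fin d) K →ₗ[K] (Fin d → K) :=
  LinearMap.pi fun j =>
    (MvPolynomial.aeval (0 : Fin d → K)).toLinearMap ∘ₗ (MvPolynomial.pderiv j).toLinearMap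

theorem linearCoeff_apply (p : MvPolynomial (Fin d) K) (j : Fin d) :
    linearCoeff p j = MvPolynomial.eval 0 (MvPolynomial.pderiv j p) := by
  simp [linearCoeff, MvPolynomial.aeval_eq_eval]

/-- Product rule at the origin. Polynomial multipliers thus act on linear parts as scalars, which
turns ideal generators into spanning vectors. -/
theorem linearCoeff_mul {p q : MvPolynomial (Fin d) K} (hp : MvPolynomial.eval 0 p = 0) :
    linearCoeff (q * p) = MvPolynomial.eval 0 q • linearCoeff p := by
  ext j
  rw [Pi.smul_apply, linearCoeff_apply, linearCoeff_apply, Derivation.leibniz, smul_eq_mul,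
    smul_eq_mul, map_add, map_mul, map_mul, hp, zero_mul, add_zero, smul_eq_mul]

/-- The linear form with given coefficients. -/
def linearForm : (Fin d → K) →ₗ[K] MvPolynomial (Fin d) K :=
  Fintype.linearCombination K MvPolynomial.X

theorem linearForm_apply (c : Fin d → K) :
    linearForm c = ∑ j, c j • (MvPolynomial.X j : MvPolynomial (Fin d) K) := rfl

theorem eval_linearForm (c x : Fin d → K) :
    MvPolynomial.eval x (linearForm c) = c ⬝ᵥ x := by
  simp [linearForm_apply, dotProduct, MvPolynomial.smul_eval]

theorem linearCoeff_linearForm (c : Fin d → K) : linearCoeff (linearForm c) = c := by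
  ext j
  simp [linearCoeff_apply, linearForm_apply, MvPolynomial.pderiv_X, Pi.single_apply,
    apply_ite]

theorem isHomogeneous_linearForm (c : Fin d → K) :
    (linearForm c : MvPolynomial (Fin d) K).IsHomogeneous 1 := by
  rw [linearForm_apply]
  refine MvPolynomial.IsHomogeneous.sum _ _ _ fun j _ => ?_
  rw [MvPolynomial.smul_eq_C_mul]
  exact MvPolynomial.isHomogeneous_C_mul_X _ _

theorem linearForm_linearCoeff {p : MvPolynomial (Fin d) K} (hp : p.IsHomogeneous 1) :
    linearForm (linearCoeff p) = p := by
  have h := hp.sum_X_mul_pderiv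
  rw [one_smul] at h
  conv_rhs => rw [← h]
  rw [linearForm_apply]
  refine Finset.sum_congr rfl fun j _ => ?_
  have h0 : (MvPolynomial.pderiv j p).totalDegree = 0 :=
    Nat.le_zero.mp (hp.pderiv (i := j)).totalDegree_le
  rw [linearCoeff_apply, MvPolynomial.totalDegree_eq_zero_iff_eq_C.mp h0, MvPolynomial.eval_C,
    MvPolynomial.smul_eq_C_mul, mul_comm]

/-- The linear forms vanishing on a subspace, by their coefficients. -/
def annihilatingCoeffs (W : Submodule K (Fin d → K)) : Submodule K (Fin d → K) :=
  W.dualAnnihilator.comap (dotProductEquiv K (Fin d)).toLinearMap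

theorem mem_annihilatingCoeffs {W : Submodule K (Fin d → K)} {c : Fin d → K} :
    c ∈ annihilatingCoeffs W ↔ ∀ x ∈ W, c ⬝ᵥ x = 0 := by
  simp [annihilatingCoeffs, Submodule.mem_dualAnnihilator]

theorem finrank_add_finrank_annihilatingCoeffs (W : Submodule K (Fin d → K)) :
    Module.finrank K W + Module.finrank K (annihilatingCoeffs W) = d := by
  have h := Subspace.finrank_add_finrank_dualAnnihilator_eq W
  have h1 : Module.finrank K (annihilatingCoeffs W) = Module.finrank K W.dualAnnihilator := by
    rw [annihilatingCoeffs, Submodule.comap_equiv_eq_map_symm, LinearEquiv.finrank_map_eq]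
  rw [h1, h, Module.finrank_fin_fun]

/-- An ideal generated by linear forms that vanish on `W` has at most `d - dim W` generators. -/
theorem spanFinrank_add_finrank_le {S : Set (MvPolynomial (Fin d) K)}
    (hS : ∀ p ∈ S, p.IsHomogeneous 1) (W : Submodule K (Fin d → K))
    (hW : ∀ x ∈ W, ∀ p ∈ S, MvPolynomial.eval x p = 0) :
    (Ideal.span S).spanFinrank + Module.finrank K W ≤ d := by
  have hle : Submodule.span K S ≤ (annihilatingCoeffs W).map linearForm := by
    rw [Submodule.span_le]
    intro p hp
    refine ⟨linearCoeff p, mem_annihilatingCoeffs.mpr fun x hx => ?_,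
      linearForm_linearCoeff (hS p hp)⟩
    rw [← eval_linearForm, linearForm_linearCoeff (hS p hp), hW x hx p hp]
  have : FiniteDimensional K (Submodule.span K S) := Submodule.finiteDimensional_of_le hle
  have h1 : Module.finrank K (Submodule.span K S) ≤
      Module.finrank K (annihilatingCoeffs W) :=
    (Submodule.finrank_mono hle).trans (Submodule.finrank_map_le _ _)
  let b := Module.finBasis K (Submodule.span K S)
  have hspan : Ideal.span S = Ideal.span (Set.range fun i => (b i : MvPolynomial (Fin d) K)) := by
    apply le_antisymm
    · rw [Ideal.span_le]
      intro p hp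
      have h2 : p ∈ Submodule.span K (Set.range fun i => (b i : MvPolynomial (Fin d) K)) := by
        have h3 := congrArg (Submodule.map (Submodule.span K S).subtype) b.span_eq
        rw [Submodule.map_span, Submodule.map_top, Submodule.range_subtype, ← Set.range_comp] at h3
        change p ∈ Submodule.span K (Set.range ((Submodule.span K S).subtype ∘ b))
        rw [h3]
        exact Submodule.subset_span hp
      exact Submodule.span_le_restrictScalars K (MvPolynomial (Fin d) K) _ h2
    · rw [Ideal.span_le]
      rintro _ ⟨i, rfl⟩
      exact Submodule.span_le_restrictScalars K (MvPolynomial (Fin d) K) _ (b i).2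
  have h2 : (Ideal.span S).spanFinrank ≤ Module.finrank K (Submodule.span K S) := by
    rw [hspan]
    refine (Submodule.spanFinrank_span_le_ncard_of_finite (Set.finite_range _)).trans ?_
    rw [← Set.image_univ]
    refine (Set.ncard_image_le Set.finite_univ).trans ?_
    simp
  have := finrank_add_finrank_annihilatingCoeffs W
  omega

/-- Linearly independent linear forms are a minimal set of generators of their ideal. -/
theorem finrank_le_spanFinrank (N : Submodule K (Fin d → K)) :
    Module.finrank K N ≤ (Ideal.span (linearForm '' (N : Set (Fin d → K)))).spanFinrank := by
  classical
  set I := Ideal.span (linearForm '' (N : Set (Fin d → K))) with hI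
  obtain ⟨T, hT, hTI⟩ := Submodule.FG.exists_span_finset_card_eq_spanFinrank
    (IsNoetherian.noetherian I)
  have hzero : ∀ p ∈ I, MvPolynomial.eval 0 p = 0 := by
    intro p hp
    have : I ≤ RingHom.ker (MvPolynomial.eval (0 : Fin d → K)) := by
      rw [hI, Ideal.span_le]
      rintro _ ⟨c, _, rfl⟩
      rw [SetLike.mem_coe, RingHom.mem_ker, eval_linearForm, dotProduct_zero]
    exact this hp
  -- The generators in `T` need not be homogeneous; their linear parts still span those of all of
  -- `I`.
  have hlin : ∀ p ∈ I, linearCoeff p ∈ Submodule.span K (linearCoeff '' (T : Set _)) := by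
    intro p hp
    rw [← hTI] at hp
    induction hp using Submodule.span_induction with
    | mem p hp => exact Submodule.subset_span ⟨p, hp, rfl⟩
    | zero => simp
    | add p q _ _ h1 h2 => rw [map_add]; exact add_mem h1 h2
    | smul q p hp h =>
      rw [smul_eq_mul, linearCoeff_mul (hzero p (hTI ▸ hp))]
      exact Submodule.smul_mem _ _ h
  have hN : N ≤ Submodule.span K ((T.image linearCoeff : Finset _) : Set (Fin d → K)) := by
    intro c hc
    rw [Finset.coe_image, ← linearCoeff_linearForm c]
    exact hlin _ (Ideal.subset_span ⟨c, hc, rfl⟩)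
  calc Module.finrank K N ≤ _ := Submodule.finrank_mono hN
    _ ≤ (T.image linearCoeff).card := finrank_span_finset_le_card _
    _ ≤ T.card := Finset.card_image_le
    _ = _ := hT

end LinearForms

/-! ### Kapranov rank as the least rank of a lift -/

section Lifts

variable {F : Type*} [Field F] {m d : ℕ}

/-- `X` is a lift of `M`: its entries have the entries of `M` as orders. -/
def IsLift (X : Matrix (Fin m) (Fin d) (SeriesField F)) (M : Matrix (Fin m) (Fin d) ℝ) : Prop :=
  ∀ i j, (X i j).orderTop = (M i j : WithTop ℝ)

/-- The ideal of all linear forms vanishing on the row space `W` has exactly `d - dim W` minimal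
generators. -/
theorem kapranovRank_le_rank {X : Matrix (Fin m) (Fin d) (SeriesField F)}
    {M : Matrix (Fin m) (Fin d) ℝ} (hX : IsLift X M) : kapranovRank F M ≤ X.rank := by
  set W := Submodule.span (SeriesField F) (Set.range X)
  have hW : X.rank = Module.finrank _ W := X.rank_eq_finrank_span_row
  set S : Set (MvPolynomial (Fin d) (SeriesField F)) :=
    linearForm '' (annihilatingCoeffs W : Set (Fin d → SeriesField F)) with hS
  have hhom : ∀ p ∈ S, p.IsHomogeneous 1 := by
    rintro _ ⟨c, _, rfl⟩
    exact isHomogeneous_linearForm c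
  have hvan : ∀ x ∈ W, ∀ p ∈ S, MvPolynomial.eval x p = 0 := by
    rintro x hx _ ⟨c, hc, rfl⟩
    rw [eval_linearForm]
    exact mem_annihilatingCoeffs.mp hc x hx
  have h1 := spanFinrank_add_finrank_le hhom W hvan
  have h2 := finrank_le_spanFinrank (annihilatingCoeffs W)
  have h3 := finrank_add_finrank_annihilatingCoeffs W
  have hmem : kapranovRank F M ≤ d - (Ideal.span S).spanFinrank := by
    refine Nat.sInf_le ⟨tropicalVariety (Ideal.span S),
      ⟨Ideal.span S, ⟨S, hhom, rfl⟩, rfl, by omega⟩, fun i => ⟨X i, fun j => ?_, fun p hp => ?_,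
        hX i⟩⟩
    · rw [← HahnSeries.orderTop_ne_top, hX i j]
      exact WithTop.coe_ne_top
    · have : Ideal.span S ≤ RingHom.ker (MvPolynomial.eval (X i)) := by
        rw [Ideal.span_le]
        intro q hq
        exact hvan _ (Submodule.subset_span ⟨i, rfl⟩) q hq
      exact this hp
  refine hmem.trans ?_
  rw [hW]
  exact Nat.sub_le_iff_le_add.mpr (h3.symm.le.trans (Nat.add_le_add_left h2 _))

theorem exists_isLift_rank_eq (M : Matrix (Fin m) (Fin d) ℝ) :
    ∃ X : Matrix (Fin m) (Fin d) (SeriesField F), IsLift X M ∧ X.rank = kapranovRank F M := by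
  obtain ⟨T, ⟨I, ⟨S, hS, rfl⟩, rfl, hD⟩, hT⟩ := Nat.sInf_mem (kapranovRank_set_nonempty F M)
  choose X hX0 hXI hXM using hT
  refine ⟨X, hXM, le_antisymm ?_ (kapranovRank_le_rank hXM)⟩
  have h := spanFinrank_add_finrank_le hS (Submodule.span (SeriesField F) (Set.range X)) ?_
  · have hr : Matrix.rank X = _ := Matrix.rank_eq_finrank_span_row X
    rw [hr, kapranovRank]
    have e : Set.range (Matrix.row X) = Set.range X := rfl
    rw [e]
    omega
  · intro x hx p hp
    have hlin : ∀ y, MvPolynomial.eval y p = linearCoeff p ⬝ᵥ y := fun y => by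
      rw [← eval_linearForm, linearForm_linearCoeff (hS p hp)]
    rw [hlin]
    induction hx using Submodule.span_induction with
    | mem x hx =>
      obtain ⟨i, rfl⟩ := hx
      rw [← hlin]
      exact hXI i p (Ideal.subset_span hp)
    | zero => simp
    | add x y _ _ h1 h2 => rw [dotProduct_add, h1, h2, add_zero]
    | smul a x _ h => rw [dotProduct_smul, h, smul_zero]

end Lifts

/-! ### Orders and constant terms of series -/

section Orders

variable {F : Type*} [Field F]

theorem orderTop_pos_of_coeff_zero {x : SeriesField F} (hx : 0 ≤ x.orderTop)
    (h : x.coeff 0 = 0) : 0 < x.orderTop :=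
  lt_of_le_of_ne hx (HahnSeries.orderTop_ne_of_coeff_eq_zero h).symm

theorem coeff_zero_mul {x y : SeriesField F} (hx : 0 ≤ x.orderTop) (hy : 0 ≤ y.orderTop) :
    (x * y).coeff 0 = x.coeff 0 * y.coeff 0 := by
  set c : SeriesField F := HahnSeries.C (x.coeff 0) with hc
  have hc0 : c.coeff 0 = x.coeff 0 := by simp [hc]
  have hcpos : 0 ≤ c.orderTop := HahnSeries.orderTop_single_le
  have hpos : 0 < (x - c).orderTop := by
    apply orderTop_pos_of_coeff_zero
    · exact (le_min hx hcpos).trans HahnSeries.min_orderTop_le_orderTop_sub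
    · rw [HahnSeries.coeff_sub, hc0, sub_self]
  have h1 : ((x - c) * y).coeff 0 = 0 := by
    apply HahnSeries.coeff_eq_zero_of_lt_orderTop
    rw [HahnSeries.orderTop_mul]
    exact lt_of_lt_of_le hpos (le_add_of_nonneg_right hy)
  have h2 : x * y = (x - c) * y + c * y := by ring
  rw [h2, HahnSeries.coeff_add, h1, zero_add, hc, HahnSeries.C_mul_eq_smul,
    HahnSeries.coeff_smul, smul_eq_mul]

theorem orderTop_div_nonneg {x y : SeriesField F} (hy : y ≠ 0) (h : y.orderTop ≤ x.orderTop) :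
    0 ≤ (x / y).orderTop := by
  by_contra hlt
  rw [not_le] at hlt
  have h1 : x.orderTop = (x / y).orderTop + y.orderTop := by
    rw [← HahnSeries.orderTop_mul, div_mul_cancel₀ x hy]
  have hy' := HahnSeries.orderTop_ne_top.mpr hy
  lift y.orderTop to ℝ using hy' with b
  lift (x / y).orderTop to ℝ using hlt.ne_top with a
  rw [h1, ← WithTop.coe_add, WithTop.coe_le_coe] at h
  rw [← WithTop.coe_zero, WithTop.coe_lt_coe] at hlt
  linarith

theorem lt_orderTop_sum {ι : Type*} {s : Finset ι} {f : ι → SeriesField F} {a : ℝ}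
    (h : ∀ i ∈ s, (a : WithTop ℝ) < (f i).orderTop) :
    (a : WithTop ℝ) < (∑ i ∈ s, f i).orderTop := by
  have := (HahnSeries.addVal ℝ F).map_lt_sum (s := s) (f := f) (g := (a : WithTop ℝ))
    WithTop.coe_ne_top (by simpa [HahnSeries.addVal_apply] using h)
  simpa [HahnSeries.addVal_apply] using this

end Orders

/-! ### Factorization over the nonnegative series -/

section Factorization

variable {F : Type*} [Field F] {m d : ℕ}

/-- The module over the series of nonnegative order spanned by finitely many vectors is free, and
some of these vectors are a basis of it. -/
theorem exists_linearIndepOn_subset (x : Fin m → Fin d → SeriesField F) :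
    ∃ s : Finset (Fin m), LinearIndepOn (SeriesField F) x s ∧
      ∀ i, x i ∈ Submodule.span (nonnegSeries F) (x '' s) := by
  classical
  obtain ⟨s, hs, hmin⟩ := (Set.toFinite {s : Finset (Fin m) |
    ∀ i, x i ∈ Submodule.span (nonnegSeries F) (x '' s)}).exists_minimal
    ⟨Finset.univ, fun i => Submodule.subset_span ⟨i, by simp, rfl⟩⟩
  refine ⟨s, ?_, hs⟩
  by_contra hli
  obtain ⟨c, hc, i, hi, hci⟩ := not_linearIndepOn_finset_iff.mp hli
  -- Dividing the dependence by its coefficient of least order puts all quotients in `K_+`, so `x p`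
  -- is redundant.
  obtain ⟨p, hp, hpmin⟩ := s.exists_min_image (fun i => (c i).orderTop) ⟨i, hi⟩
  have hcp : c p ≠ 0 := by
    intro h0
    have := hpmin i hi
    rw [h0, HahnSeries.orderTop_zero, top_le_iff, HahnSeries.orderTop_eq_top] at this
    exact hci this
  let q : Fin m → nonnegSeries F := fun i =>
    if h : i ∈ s then ⟨-(c i / c p), (nonnegSeries F).neg_mem
      (orderTop_div_nonneg hcp (hpmin i h))⟩ else 0
  have hxp : x p = ∑ i ∈ s.erase p, q i • x i := by
    have h1 : ∀ i ∈ s.erase p, q i • x i = -((c p)⁻¹ • c i • x i) := by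
      intro i hi
      have h2 : (q i : SeriesField F) = -(c i / c p) := by
        simp [q, Finset.mem_of_mem_erase hi]
      change (q i : SeriesField F) • x i = _
      rw [h2, smul_smul, ← neg_smul, div_eq_mul_inv, mul_comm]
    rw [Finset.sum_congr rfl h1, Finset.sum_neg_distrib, ← Finset.smul_sum,
      Finset.sum_erase_eq_sub hp, hc, zero_sub, smul_neg, neg_neg, smul_smul,
      inv_mul_cancel₀ hcp, one_smul]
  have hle : Submodule.span (nonnegSeries F) (x '' s) ≤
      Submodule.span (nonnegSeries F) (x '' (s.erase p : Finset (Fin m))) := by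
    rw [Submodule.span_le]
    rintro _ ⟨i, hi, rfl⟩
    by_cases hip : i = p
    · rw [hip, hxp]
      exact Submodule.sum_mem _ fun j hj =>
        Submodule.smul_mem _ _ (Submodule.subset_span ⟨j, hj, rfl⟩)
    · exact Submodule.subset_span ⟨i, Finset.mem_erase.mpr ⟨hip, hi⟩, rfl⟩
  exact Finset.notMem_erase p s (hmin (fun i => hle (hs i)) (Finset.erase_subset p s) hp)

/-- The rows of `X` are combinations of `X.rank` of them, with coefficients of nonnegative
order. -/
theorem exists_rows_factorization (X : Matrix (Fin m) (Fin d) (SeriesField F)) :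
    ∃ (e : Fin X.rank → Fin m) (A : Fin m → Fin X.rank → nonnegSeries F),
      ∀ i j, X i j = ∑ l, (A i l : SeriesField F) * X (e l) j := by
  obtain ⟨s, hli, hs⟩ := exists_linearIndepOn_subset X.row
  have hspan : Submodule.span (SeriesField F) (Set.range fun i : s => X.row i) =
      Submodule.span (SeriesField F) (Set.range X.row) := by
    apply le_antisymm
    · apply Submodule.span_mono
      rintro _ ⟨i, rfl⟩
      exact ⟨i, rfl⟩
    · rw [Submodule.span_le]
      rintro _ ⟨i, rfl⟩
      have h := Submodule.span_le_restrictScalars (nonnegSeries F) (SeriesField F) _ (hs i)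
      rw [Set.image_eq_range] at h
      exact h
  have hcard : s.card = X.rank := by
    rw [Matrix.rank_eq_finrank_span_row, ← hspan, ← Fintype.card_coe s]
    exact (finrank_span_eq_card hli).symm
  choose c hc using fun i =>
    (Submodule.mem_span_image_finset_iff_exists_fun (nonnegSeries F)).mp (hs i)
  let e : Fin X.rank ≃ s := (s.equivFinOfCardEq hcard).symm
  refine ⟨fun l => e l, fun i l => c i (e l), fun i j => ?_⟩
  have hij : X i j = (∑ l, c i l • X.row l) j := by rw [hc i]; rfl
  rw [hij, Finset.sum_apply, ← e.sum_comp]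
  rfl

theorem rank_le_of_eq_mul {k : ℕ} {X : Matrix (Fin m) (Fin d) (SeriesField F)}
    (A : Matrix (Fin m) (Fin k) (SeriesField F)) (B : Matrix (Fin k) (Fin d) (SeriesField F))
    (h : X = A * B) : X.rank ≤ k := by
  rw [h]
  exact (Matrix.rank_mul_le_left A B).trans (Matrix.rank_le_width A)

/-- The `w j` are read off from rows of an optimal lift, so their orders are entries of `M`; the
(0,1) case needs this. -/
theorem exists_nonneg_factorization {M : Matrix (Fin m) (Fin d) ℝ} (hM : ∀ i j, 0 ≤ M i j) :
    ∃ (e : Fin (kapranovRank F M) → Fin m) (v : Fin m → Fin (kapranovRank F M) → nonnegSeries F)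
      (w : Fin d → Fin (kapranovRank F M) → nonnegSeries F),
      (∀ j l, (w j l : SeriesField F).orderTop = (M (e l) j : WithTop ℝ)) ∧
      ∀ i j, ((v i ⬝ᵥ w j : nonnegSeries F) : SeriesField F).orderTop = (M i j : WithTop ℝ) := by
  obtain ⟨X, hX, hr⟩ := exists_isLift_rank_eq (F := F) M
  obtain ⟨e, A, hA⟩ := exists_rows_factorization X
  rw [← hr]
  have hnonneg : ∀ i j, X i j ∈ nonnegSeries F := fun i j => by
    change 0 ≤ (X i j).orderTop
    rw [hX i j]
    exact_mod_cast hM i j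
  refine ⟨e, A, fun j l => ⟨X (e l) j, hnonneg _ _⟩, fun j l => hX _ _, fun i j => ?_⟩
  rw [← hX i j, hA i j]
  simp [dotProduct]

end Factorization

/-! ### Zero-one matrices -/

section ConstantTerms

variable {F : Type*} [Field F] {m d : ℕ}

theorem coeff_zero_dotProduct {k : ℕ} (v w : Fin k → nonnegSeries F) :
    ((v ⬝ᵥ w : nonnegSeries F) : SeriesField F).coeff 0 =
      (fun l => (v l : SeriesField F).coeff 0) ⬝ᵥ fun l => (w l : SeriesField F).coeff 0 := by
  simp only [dotProduct, AddSubmonoidClass.coe_finsetSum, Subring.coe_mul, HahnSeries.coeff_sum]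
  exact Finset.sum_congr rfl fun l _ => coeff_zero_mul (v l).2 (w l).2

theorem exists_vectors_of_zero_one {M : Matrix (Fin m) (Fin d) ℝ}
    (hM : ∀ i j, M i j = 0 ∨ M i j = 1) :
    ∃ (v : Fin m → Fin (kapranovRank F M) → F) (w : Fin d → Fin (kapranovRank F M) → F),
      (∀ i j, v i ≠ 0 ∨ w j ≠ 0) ∧ ∀ i j, M i j = 0 ↔ v i ⬝ᵥ w j ≠ 0 := by
  obtain ⟨e, v, w, hw, h⟩ := exists_nonneg_factorization (F := F) (M := M)
    fun i j => (hM i j).elim (fun h => h.ge) fun h => zero_le_one.trans h.ge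
  refine ⟨fun i l => (v i l : SeriesField F).coeff 0, fun j l => (w j l : SeriesField F).coeff 0,
    fun i j => ?_, fun i j => ?_⟩
  · by_contra! hzero
    obtain ⟨hv0, hw0⟩ := hzero
    have hle : M i j ≤ 1 := (hM i j).elim (fun h => h.le.trans zero_le_one) le_of_eq
    -- A vanishing constant term forces order 1 in `w j`; with positive orders in `v i`, the product
    -- would have order above 1.
    have hw1 : ∀ l, M (e l) j = 1 := fun l => (hM (e l) j).resolve_left fun h0 =>
      HahnSeries.coeff_orderTop_ne ((hw j l).trans (by rw [h0])) (congrFun hw0 l)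
    have hlt : ((1 : ℝ) : WithTop ℝ) < ((v i ⬝ᵥ w j : nonnegSeries F) : SeriesField F).orderTop := by
      simp only [dotProduct, AddSubmonoidClass.coe_finsetSum, Subring.coe_mul]
      refine lt_orderTop_sum fun l _ => ?_
      rw [HahnSeries.orderTop_mul, hw j l, hw1 l]
      have hpos := orderTop_pos_of_coeff_zero (v i l).2 (congrFun hv0 l)
      simpa using WithTop.add_lt_add_right (z := ((1 : ℝ) : WithTop ℝ)) WithTop.coe_ne_top hpos
    rw [h i j, WithTop.coe_lt_coe] at hlt
    exact absurd hle (not_le.mpr hlt)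
  · rw [← coeff_zero_dotProduct]
    constructor
    · intro h0
      exact HahnSeries.coeff_orderTop_ne ((h i j).trans (by rw [h0]))
    · intro h0
      refine (hM i j).resolve_right fun h1 => h0 (HahnSeries.coeff_eq_zero_of_lt_orderTop ?_)
      rw [h i j, h1, WithTop.coe_lt_coe]
      exact one_pos

theorem single_sum {ι : Type*} (s : Finset ι) (a : ℝ) (f : ι → F) :
    (HahnSeries.single a (∑ i ∈ s, f i) : SeriesField F) = ∑ i ∈ s, HahnSeries.single a (f i) :=
  map_sum (HahnSeries.single.addMonoidHom a) f s

theorem orderTop_of_coeff_zero_ne {p q r : F} (hp : p ≠ 0) :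
    (HahnSeries.single 0 p + HahnSeries.single 1 q + HahnSeries.single 2 r :
      SeriesField F).orderTop = ((0 : ℝ) : WithTop ℝ) := by
  have h1 : ((0 : ℝ) : WithTop ℝ) < (HahnSeries.single 1 q : SeriesField F).orderTop :=
    HahnSeries.lt_orderTop_single one_pos
  have h2 : ((0 : ℝ) : WithTop ℝ) < (HahnSeries.single 2 r : SeriesField F).orderTop :=
    HahnSeries.lt_orderTop_single two_pos
  rw [add_assoc, HahnSeries.orderTop_add_eq_left, HahnSeries.orderTop_single hp]
  rw [HahnSeries.orderTop_single hp]
  exact (lt_min h1 h2).trans_le HahnSeries.min_orderTop_le_orderTop_add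

theorem orderTop_of_coeff_one_ne {q r : F} (hq : q ≠ 0) :
    (HahnSeries.single 0 0 + HahnSeries.single 1 q + HahnSeries.single 2 r :
      SeriesField F).orderTop = ((1 : ℝ) : WithTop ℝ) := by
  have h2 : ((1 : ℝ) : WithTop ℝ) < (HahnSeries.single 2 r : SeriesField F).orderTop :=
    HahnSeries.lt_orderTop_single one_lt_two
  rw [HahnSeries.single_eq_zero, zero_add, HahnSeries.orderTop_add_eq_left,
    HahnSeries.orderTop_single hq]
  rwa [HahnSeries.orderTop_single hq]

/-- Over an infinite field, the vectors `v i` and `w j` have first order perturbations for which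
the first order terms of all scalar products are nonzero. -/
theorem exists_perturbation [Infinite F] {k : ℕ} {v : Fin m → Fin k → F} {w : Fin d → Fin k → F}
    (h : ∀ i j, v i ≠ 0 ∨ w j ≠ 0) :
    ∃ (a : Fin m → Fin k → F) (b : Fin d → Fin k → F), ∀ i j, v i ⬝ᵥ b j + a i ⬝ᵥ w j ≠ 0 := by
  let f : Fin m × Fin d → Module.Dual F ((Fin m → Fin k → F) × (Fin d → Fin k → F)) := fun p =>
    { toFun := fun x => v p.1 ⬝ᵥ x.2 p.2 + x.1 p.1 ⬝ᵥ w p.2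
      map_add' := fun x y => by simp [add_dotProduct, dotProduct_add]; ring
      map_smul' := fun c x => by simp [smul_dotProduct, dotProduct_smul, mul_add] }
  -- Finitely many nonzero functionals over an infinite field have a common point of nonvanishing.
  obtain ⟨x, hx⟩ := Module.Dual.exists_forall_ne_zero_of_forall_exists f fun p => by
    rcases h p.1 p.2 with hv | hw
    · obtain ⟨l, hl⟩ := Function.ne_iff.mp hv
      exact ⟨(0, fun _ => Pi.single l 1), by simpa [f] using hl⟩
    · obtain ⟨l, hl⟩ := Function.ne_iff.mp hw
      exact ⟨(fun _ => Pi.single l 1, 0), by simpa [f] using hl⟩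
  exact ⟨x.1, x.2, fun i j => hx (i, j)⟩

theorem kapranovRank_le_of_vectors [Infinite F] {M : Matrix (Fin m) (Fin d) ℝ}
    (hM : ∀ i j, M i j = 0 ∨ M i j = 1) {k : ℕ} {v : Fin m → Fin k → F} {w : Fin d → Fin k → F}
    (h0 : ∀ i j, v i ≠ 0 ∨ w j ≠ 0) (h : ∀ i j, M i j = 0 ↔ v i ⬝ᵥ w j ≠ 0) :
    kapranovRank F M ≤ k := by
  obtain ⟨a, b, hab⟩ := exists_perturbation h0
  let A : Matrix (Fin m) (Fin k) (SeriesField F) := fun i l =>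
    HahnSeries.single 0 (v i l) + HahnSeries.single 1 (a i l)
  let B : Matrix (Fin k) (Fin d) (SeriesField F) := fun l j =>
    HahnSeries.single 0 (w j l) + HahnSeries.single 1 (b j l)
  have hAB : ∀ i j, (A * B) i j = HahnSeries.single 0 (v i ⬝ᵥ w j) +
      HahnSeries.single 1 (v i ⬝ᵥ b j + a i ⬝ᵥ w j) + HahnSeries.single 2 (a i ⬝ᵥ b j) := by
    intro i j
    rw [Matrix.mul_apply]
    simp only [A, B, dotProduct, HahnSeries.single_add, single_sum, ← Finset.sum_add_distrib]
    refine Finset.sum_congr rfl fun l _ => ?_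
    simp only [add_mul, mul_add, HahnSeries.single_mul_single]
    norm_num
    abel
  have hlift : IsLift (A * B) M := by
    intro i j
    rw [hAB]
    rcases hM i j with hij | hij
    · rw [hij]
      exact orderTop_of_coeff_zero_ne ((h i j).mp hij)
    · have hvw : v i ⬝ᵥ w j = 0 := by
        by_contra hne
        rw [(h i j).mpr hne] at hij
        exact zero_ne_one hij
      rw [hij, hvw]
      exact orderTop_of_coeff_one_ne (hab i j)
  exact (kapranovRank_le_rank hlift).trans (rank_le_of_eq_mul A B rfl)

end ConstantTerms

end KapranovRank

end

theorem proposition1 {F : Type*} [Field F] (n : ℕ) :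
    (Infinite F → ∀ M : Matrix (Fin n) (Fin n) ℝ, (∀ i j, M i j = 0 ∨ M i j = 1) →
      (¬ ((∃ i, ∀ j, M i j = 1) ∧ (∃ j, ∀ i, M i j = 1)) →
        IsLeast {k : ℕ | ∃ v w : Fin n → Fin k → F,
          ∀ i j, M i j = 0 ↔ v i ⬝ᵥ w j ≠ 0} (KapranovRank.kapranovRank F M)) ∧
      IsLeast {k : ℕ | ∃ v w : Fin n → Fin k → F,
        (∀ i j, v i ≠ 0 ∨ w j ≠ 0) ∧
        ∀ i j, M i j = 0 ↔ v i ⬝ᵥ w j ≠ 0} (KapranovRank.kapranovRank F M)) ∧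
    (∀ M : Matrix (Fin n) (Fin n) ℝ, (∀ i j, 0 ≤ M i j) →
      IsLeast {k : ℕ | ∃ v w : Fin n → Fin k → KapranovRank.nonnegSeries F,
        ∀ i j, ((v i ⬝ᵥ w j : KapranovRank.nonnegSeries F) : HahnSeries ℝ F).orderTop =
          (M i j : WithTop ℝ)} (KapranovRank.kapranovRank F M)) := by
  refine ⟨fun _ M hM => ⟨fun hones => ⟨?_, ?_⟩, ⟨?_, ?_⟩⟩, fun M hM => ⟨?_, ?_⟩⟩
  · obtain ⟨v, w, -, h⟩ := KapranovRank.exists_vectors_of_zero_one (F := F) hM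
    exact ⟨v, w, h⟩
  · rintro k ⟨v, w, h⟩
    refine KapranovRank.kapranovRank_le_of_vectors hM (fun i j => ?_) h
    by_contra! hzero
    have hone : ∀ i j, v i ⬝ᵥ w j = 0 → M i j = 1 := fun i j h0 =>
      (hM i j).resolve_left fun h1 => (h i j).mp h1 h0
    -- A zero `v i` makes row `i` all ones, and a zero `w j` makes column `j` all ones.
    exact hones ⟨⟨i, fun j' => hone i j' (by rw [hzero.1, zero_dotProduct])⟩,
      ⟨j, fun i' => hone i' j (by rw [hzero.2, dotProduct_zero])⟩⟩
  · exact KapranovRank.exists_vectors_of_zero_one hM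
  · rintro k ⟨v, w, h0, h⟩
    exact KapranovRank.kapranovRank_le_of_vectors hM h0 h
  · obtain ⟨-, v, w, -, h⟩ := KapranovRank.exists_nonneg_factorization (F := F) hM
    exact ⟨v, w, h⟩
  · rintro k ⟨v, w, h⟩
    let A : Matrix (Fin n) (Fin k) (KapranovRank.SeriesField F) := fun i l => v i l
    let B : Matrix (Fin k) (Fin n) (KapranovRank.SeriesField F) := fun l j => w j l
    have hlift : KapranovRank.IsLift (A * B) M := fun i j => by
      rw [← h i j]
      rw [Matrix.mul_apply]
      simp [A, B, dotProduct]
    exact (KapranovRank.kapranovRank_le_rank hlift).trans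
      (KapranovRank.rank_le_of_eq_mul A B rfl)
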